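/- Let $d\ge 0$ be an integer and $E\subset\mathbb{R}^d$ a Borel set. Then $$\underline{\dim}_{MB}E\;\le\;\overline{\dim}_{C}E\;\le\;\dim_P E .$$ Here $B(x,r)$ is the closed Euclidean ball with centre $x$ and radius $r$, $|U|$ is the diameter of a set $U$, and the dimensions are the following elements of $[0,\infty]$. (i) For a non-empty compact set $F\subset\mathbb{R}^d$ and $r>0$ let $N_r(F)$ be the least number of sets of diameter at most $r$ that cover $F$, and let $\underline{\dim}_{B}F=\liminf_{r\to0^+}\frac{\log N_r(F)}{-\log r}$ be the lower box-counting dimension; put $\underline{\dim}_B\emptyset=0$. The modified lower box dimension is $$\underline{\dim}_{MB}E=\inf\Big\{\sup_{i}\,\underline{\dim}_{B}E_i:\ E\subset\bigcup_{i=1}^\infty E_i,\ \text{every } E_i\subset\mathbb{R}^d \text{ compact}\Big\}.$$ (ii) The upper correlation dimension is $$\overline{\dim}_{C}E=\sup_{\mu}\ \limsup_{r\to0^+}\frac{\log\int\mu(B(x,r))\,d\mu(x)}{\log r},$$ where the supremum is over all Borel probability measures $\mu$ on $\mathbb{R}^d$ with $\mu(\mathbb{R}^d\setminus E)=0$ (and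 is $0$ if $E=\emptyset$). (iii) For $s\ge0$, $\delta>0$ and $A\subset\mathbb{R}^d$ let $\mathcal{P}^s_\delta(A)=\sup\sum_i|B_i|^s$, the supremum being over all finite or countable families $\{B_i\}$ of disjoint closed balls of positive radius at most $\delta$ with centres in $A$, with the convention $0^0=1$. Let $\mathcal{P}^s_0(A)=\inf_{\delta>0}\mathcal{P}^s_\delta(A)$ and $\mathcal{P}^s(E)=\inf\big\{\sum_{i=1}^\infty\mathcal{P}^s_0(E_i): E\subset\bigcup_{i=1}^\infty E_i\big\}$. The packing dimension is $$\dim_P E=\inf\{s\ge0:\mathcal{P}^s(E)=0\}.$$ -/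

import Mathlib

open MeasureTheory Filter Topology
open scoped ENNReal NNReal

namespace FractalDim

/-- `N_r(E)`: the least number of sets of diameter at most `r` that cover `E`
(finite, hence meaningful, for every bounded subset of Euclidean space). -/
noncomputable def coverNumber {X : Type*} [MetricSpace X] (r : ℝ) (E : Set X) : ℕ :=
  sInf {n : ℕ | ∃ U : Fin n → Set X,
    (∀ i, Metric.ediam (U i) ≤ ENNReal.ofReal r) ∧ E ⊆ ⋃ i, U i}

/-- The lower box-counting dimension `liminf_{r → 0} log N_r(E) / (-log r)` of a bounded set `E`.
For `0 < r < 1` the quotient is nonnegative, so that `ENNReal.ofReal` does not change it.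
The empty set gets the value `0`. -/
noncomputable def lowerBoxDim {X : Type*} [MetricSpace X] (E : Set X) : ℝ≥0∞ :=
  liminf (fun r : ℝ => ENNReal.ofReal (Real.log (coverNumber r E : ℝ) / (-Real.log r)))
    (𝓝[>] (0 : ℝ))

/-- The modified lower box dimension: the infimum, over all countable covers of `E` by compact
sets, of the supremum of the lower box-counting dimensions of the members of the cover. -/
noncomputable def modifiedLowerBoxDim {X : Type*} [MetricSpace X] (E : Set X) : ℝ≥0∞ :=
  ⨅ (F : ℕ → Set X) (_ : ∀ i, IsCompact (F i)) (_ : E ⊆ ⋃ i, F i), ⨆ i, lowerBoxDim (F i)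

/-- `∫ μ(B(x,r)) dμ(x)`, where `B(x,r)` is the closed ball. -/
noncomputable def correlationIntegral {X : Type*} [MetricSpace X] [MeasurableSpace X]
    (μ : Measure X) (r : ℝ) : ℝ≥0∞ :=
  ∫⁻ x, μ (Metric.closedBall x r) ∂μ

/-- The upper correlation dimension `limsup_{r → 0} log (∫ μ(B(x,r)) dμ(x)) / log r` of a
probability measure `μ`. The integral is at most `1`, so that the quotient is nonnegative
for `0 < r < 1` and `ENNReal.ofReal` does not change it. -/
noncomputable def upperCorrelationDimMeasure {X : Type*} [MetricSpace X] [MeasurableSpace X]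
    (μ : Measure X) : ℝ≥0∞ :=
  limsup (fun r : ℝ => ENNReal.ofReal (Real.log (correlationIntegral μ r).toReal / Real.log r))
    (𝓝[>] (0 : ℝ))

/-- The upper correlation dimension of a set `E`: the supremum of the upper correlation
dimensions of the Borel probability measures that are supported by `E`. -/
noncomputable def upperCorrelationDim {X : Type*} [MetricSpace X] [MeasurableSpace X]
    (E : Set X) : ℝ≥0∞ :=
  ⨆ (μ : Measure X) (_ : IsProbabilityMeasure μ) (_ : μ Eᶜ = 0), upperCorrelationDimMeasure μ

/-- A `δ`-packing of `E`: a countable family of disjoint closed balls of positive radius at most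
`δ` with centres in `E`; a ball is given by its centre and its radius. -/
def IsPacking {X : Type*} [MetricSpace X] (δ : ℝ) (E : Set X) (t : Set (X × ℝ)) : Prop :=
  t.Countable ∧ (∀ p ∈ t, p.1 ∈ E ∧ 0 < p.2 ∧ p.2 ≤ δ) ∧
    t.PairwiseDisjoint (fun p => Metric.closedBall p.1 p.2)

/-- `𝒫_δ^s(E)`: the supremum of `∑ |B_i|^s` over the `δ`-packings `{B_i}` of `E`, where `|B|` is
the diameter of `B`. -/
noncomputable def packingSup {X : Type*} [MetricSpace X] (s δ : ℝ) (E : Set X) : ℝ≥0∞ :=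
  ⨆ (t : Set (X × ℝ)) (_ : IsPacking δ E t),
    ∑' p : t, Metric.ediam (Metric.closedBall p.1.1 p.1.2) ^ s

/-- The `s`-dimensional packing premeasure `𝒫_0^s(E)`. -/
noncomputable def packingPremeasure {X : Type*} [MetricSpace X] (s : ℝ) (E : Set X) : ℝ≥0∞ :=
  ⨅ (δ : ℝ) (_ : 0 < δ), packingSup s δ E

/-- The `s`-dimensional packing measure `𝒫^s(E)`. -/
noncomputable def packingMeasure {X : Type*} [MetricSpace X] (s : ℝ) (E : Set X) : ℝ≥0∞ :=
  ⨅ (F : ℕ → Set X) (_ : E ⊆ ⋃ i, F i), ∑' i, packingPremeasure s (F i)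

/-- The packing dimension `inf {s ≥ 0 : 𝒫^s(E) = 0}`. -/
noncomputable def packingDim {X : Type*} [MetricSpace X] (E : Set X) : ℝ≥0∞ :=
  ⨅ (s : ℝ≥0) (_ : packingMeasure (s : ℝ) E = 0), (s : ℝ≥0∞)

end FractalDim

namespace FractalDim

/-! ### Separated sets and covers -/

section Separated

variable {X : Type*} [MetricSpace X]

/-! Upper bound: if `𝒫^s(E) = 0`, some piece `F` of a cover of `E` has positive `μ`-mass and admits
no fine packing of `s`-sum at least 1. A maximal separated set then covers `F` by at most `r ^ (-s)`
balls of radius comparable to `r`, and pigeonhole (`le_correlationIntegral_of_subset`) bounds the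
correlation integral below by a constant times `r ^ s`.

Lower bound: let `s` be below the modified lower box dimension. A Borel set `E` is a continuous
image `f(X)` of a Polish space, and `exists_modifiedLowerBoxDim_kernel` gives `K ⊆ X` all of whose
relatively open pieces have image of dimension above `s`. Since the lower box dimension is a liminf,
finitely many such images contain large separated sets at one common scale. Iterating this gives a
tree in `X`. Completeness of `X` keeps its limit points in `X`, hence their images in `E`, although
`E` need not be closed. The image of the uniform product measure gives every ball of radius `r`
centred on the image of the limit points mass at most `r ^ s`, for a sequence of radii `r → 0`; a
limsup needs no more. -/

theorem exists_separated_finset {A : Set X} {ε : ℝ} (hε : 0 ≤ ε) (n : ℕ)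
    (h : ∀ t : Finset X, ↑t ⊆ A → t.card < n → ¬ A ⊆ ⋃ x ∈ t, Metric.closedBall x ε) :
    ∃ t : Finset X, ↑t ⊆ A ∧ t.card = n ∧ (t : Set X).Pairwise (fun x y => ε < dist x y) := by
  classical
  induction n with
  | zero => exact ⟨∅, by simp, rfl, by simp⟩
  | succ n ih =>
    obtain ⟨t, htA, htn, hts⟩ := ih fun t h1 h2 => h t h1 (by omega)
    obtain ⟨y, hyA, hy⟩ := Set.not_subset.1 (h t htA (by omega))
    simp only [Set.mem_iUnion, Metric.mem_closedBall, not_exists, not_le] at hy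
    have hyt : y ∉ t := fun hyt => by
      have := hy y hyt
      rw [dist_self] at this
      linarith
    refine ⟨insert y t, ?_, by rw [Finset.card_insert_of_notMem hyt, htn], ?_⟩
    · rw [Finset.coe_insert]
      exact Set.insert_subset hyA htA
    · rw [Finset.coe_insert]
      refine hts.insert fun b hb _ => ⟨hy b hb, ?_⟩
      rw [dist_comm]
      exact hy b hb

theorem coverNumber_closure_le {A : Set X} {ε r : ℝ} (hr : 2 * ε ≤ r) {t : Finset X}
    (h : A ⊆ ⋃ x ∈ t, Metric.closedBall x ε) : coverNumber r (closure A) ≤ t.card := by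
  refine Nat.sInf_le ⟨fun i => Metric.closedBall (t.equivFin.symm i : X) ε, fun i => ?_, ?_⟩
  · refine Metric.ediam_le_of_forall_dist_le fun x hx y hy => ?_
    have := dist_triangle_right x y (t.equivFin.symm i : X)
    rw [Metric.mem_closedBall] at hx hy
    linarith
  · have hc : IsClosed (⋃ x ∈ t, Metric.closedBall x ε) :=
      t.finite_toSet.isClosed_biUnion fun x _ => Metric.isClosed_closedBall
    refine (closure_minimal h hc).trans fun y hy => ?_
    simp only [Set.mem_iUnion] at hy ⊢
    obtain ⟨x, hx, hyx⟩ := hy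
    exact ⟨t.equivFin ⟨x, hx⟩, by simpa using hyx⟩

end Separated

/-! ### Estimates of the correlation integral -/

section Correlation

variable {X : Type*} [MetricSpace X] [MeasurableSpace X]

/-- Pigeonhole: the balls of mass below `μ F / (2 * t.card)` carry at most half of `μ F`, so the
union `G` of the others has mass at least `μ F / 2`. A ball of radius `ρ` lies in the ball of radius
`2 * ρ` about each of its points. Integrating over `G` allows `F` to be non-measurable. -/
theorem le_correlationIntegral_of_subset [BorelSpace X] (μ : Measure X) [IsFiniteMeasure μ] {F : Set X}
    {t : Finset X} {ρ : ℝ} (hF : F ⊆ ⋃ x ∈ t, Metric.closedBall x ρ) (h0 : μ F ≠ 0) :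
    μ F / (2 * t.card) * (μ F / 2) ≤ correlationIntegral μ (2 * ρ) := by
  classical
  have hN : (t.card : ℝ≥0∞) ≠ 0 := by
    intro h
    have : t = ∅ := by simpa using h
    subst this
    exact h0 (measure_mono_null hF (by simp))
  set k := μ F / (2 * t.card) with hk
  have hNk : t.card * k = μ F / 2 := by
    rw [hk, div_eq_mul_inv, div_eq_mul_inv, ENNReal.mul_inv (by simp) (by simp)]
    calc (t.card : ℝ≥0∞) * (μ F * (2⁻¹ * (t.card : ℝ≥0∞)⁻¹))
        = μ F * 2⁻¹ * (t.card * (t.card : ℝ≥0∞)⁻¹) := by ring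
      _ = μ F * 2⁻¹ := by rw [ENNReal.mul_inv_cancel hN (by simp), mul_one]
  set good := t.filter fun x => k ≤ μ (Metric.closedBall x ρ)
  set bad := t.filter fun x => ¬ k ≤ μ (Metric.closedBall x ρ)
  set G := ⋃ x ∈ good, Metric.closedBall x ρ
  have hGm : MeasurableSet G :=
    Finset.measurableSet_biUnion _ fun x _ => Metric.isClosed_closedBall.measurableSet
  have hsub : F ⊆ G ∪ ⋃ x ∈ bad, Metric.closedBall x ρ := by
    intro y hy
    obtain ⟨x, hx, hyx⟩ := Set.mem_iUnion₂.1 (hF hy)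
    by_cases hkx : k ≤ μ (Metric.closedBall x ρ)
    · exact Or.inl (Set.mem_iUnion₂.2 ⟨x, Finset.mem_filter.2 ⟨hx, hkx⟩, hyx⟩)
    · exact Or.inr (Set.mem_iUnion₂.2 ⟨x, Finset.mem_filter.2 ⟨hx, hkx⟩, hyx⟩)
  have hbadle : μ (⋃ x ∈ bad, Metric.closedBall x ρ) ≤ μ F / 2 := by
    calc μ (⋃ x ∈ bad, Metric.closedBall x ρ)
        ≤ ∑ x ∈ bad, μ (Metric.closedBall x ρ) := measure_biUnion_finset_le _ _
      _ ≤ ∑ _x ∈ bad, k := Finset.sum_le_sum fun x hx => by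
          have := (Finset.mem_filter.1 hx).2
          exact (not_le.1 this).le
      _ = bad.card * k := by simp
      _ ≤ t.card * k := by gcongr; exact Finset.filter_subset _ _
      _ = μ F / 2 := hNk
  have hGle : μ F / 2 ≤ μ G := by
    have h1 : μ F / 2 + μ F / 2 ≤ μ G + μ F / 2 := by
      rw [ENNReal.add_halves]
      calc μ F ≤ μ (G ∪ ⋃ x ∈ bad, Metric.closedBall x ρ) := measure_mono hsub
        _ ≤ μ G + μ (⋃ x ∈ bad, Metric.closedBall x ρ) := measure_union_le _ _
        _ ≤ μ G + μ F / 2 := by gcongr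
    refine (ENNReal.add_le_add_iff_right ?_).1 h1
    exact ENNReal.div_ne_top (measure_ne_top _ _) (by simp)
  calc k * (μ F / 2) ≤ k * μ G := by gcongr
    _ = ∫⁻ _ in G, k ∂μ := by simp
    _ ≤ ∫⁻ x in G, μ (Metric.closedBall x (2 * ρ)) ∂μ := by
        refine setLIntegral_mono' hGm fun y hy => ?_
        obtain ⟨x, hx, hyx⟩ := Set.mem_iUnion₂.1 hy
        refine (Finset.mem_filter.1 hx).2.trans (measure_mono ?_)
        refine Metric.closedBall_subset_closedBall' ?_
        rw [Metric.mem_closedBall, dist_comm] at hyx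
        linarith
    _ ≤ correlationIntegral μ (2 * ρ) := setLIntegral_le_lintegral _ _

theorem correlationIntegral_le_one (μ : Measure X) [IsProbabilityMeasure μ] (r : ℝ) :
    correlationIntegral μ r ≤ 1 := by
  calc correlationIntegral μ r ≤ ∫⁻ _, 1 ∂μ := lintegral_mono fun x => prob_le_one
    _ = 1 := by simp

/-- Needed because `Real.log 0 = 0`. A point of the support of `μ` has a ball of positive mass,
which serves as a one-ball cover of itself. -/
theorem correlationIntegral_pos [BorelSpace X] [SecondCountableTopology X] (μ : Measure X)
    [IsProbabilityMeasure μ] {r : ℝ} (hr : 0 < r) : 0 < correlationIntegral μ r := by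
  obtain ⟨x, -, hx⟩ := exists_mem_forall_mem_nhdsWithin_pos_measure (μ := μ) (s := Set.univ)
    (by simp)
  rw [nhdsWithin_univ] at hx
  have hpos := hx _ (Metric.closedBall_mem_nhds x (half_pos hr))
  have h := le_correlationIntegral_of_subset μ (t := {x}) (ρ := r / 2)
    (F := Metric.closedBall x (r / 2)) (by simp) hpos.ne'
  rw [mul_div_cancel₀ r two_ne_zero] at h
  refine lt_of_lt_of_le (ENNReal.mul_pos ?_ ?_) h
  · exact (ENNReal.div_pos hpos.ne' (by simp)).ne'
  · exact (ENNReal.div_pos hpos.ne' (by simp)).ne'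

theorem upperCorrelationDimMeasure_le_of_eventually (μ : Measure X) [IsProbabilityMeasure μ]
    {C : ℝ} (hC : 0 < C) {s : ℝ≥0}
    (h : ∀ᶠ r in 𝓝[>] (0 : ℝ), C * r ^ (s : ℝ) ≤ (correlationIntegral μ r).toReal) :
    upperCorrelationDimMeasure μ ≤ s := by
  -- The slack `ε` absorbs the constant: `r ^ ε ≤ C` for small `r`.
  refine ENNReal.le_of_forall_pos_le_add fun ε hε _ => ?_
  refine limsup_le_of_le (by isBoundedDefault) ?_
  have hlim : Tendsto (fun r : ℝ => r ^ (ε : ℝ)) (𝓝[>] 0) (𝓝 0) := by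
    have : Tendsto (fun r : ℝ => r ^ (ε : ℝ)) (𝓝 0) (𝓝 ((0 : ℝ) ^ (ε : ℝ))) :=
      (Real.continuousAt_rpow_const 0 ε (Or.inr (by positivity))).tendsto
    rw [Real.zero_rpow (by positivity)] at this
    exact this.mono_left nhdsWithin_le_nhds
  filter_upwards [h, hlim.eventually_le_const hC, self_mem_nhdsWithin,
    Ioo_mem_nhdsGT (zero_lt_one' ℝ)] with r h1 h2 hr0 hr1
  have hr0 : 0 < r := hr0
  have hlog : Real.log r < 0 := Real.log_neg hr0 hr1.2
  have h3 : r ^ ((s : ℝ) + ε) ≤ (correlationIntegral μ r).toReal := by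
    rw [add_comm, Real.rpow_add hr0]
    exact (mul_le_mul_of_nonneg_right h2 (by positivity)).trans h1
  have h4 := Real.log_le_log (by positivity) h3
  rw [Real.log_rpow hr0] at h4
  rw [← ENNReal.coe_add, ← ENNReal.ofReal_coe_nnreal]
  refine ENNReal.ofReal_le_ofReal ?_
  rw [div_le_iff_of_neg hlog]
  exact_mod_cast h4

end Correlation

/-! ### Packings and the bound by the packing dimension -/

section Packing

variable {V : Type*} [NormedAddCommGroup V] [NormedSpace ℝ V]

theorem ofReal_le_ediam_closedBall [Nontrivial V] (x : V) {r : ℝ} (hr : 0 ≤ r) :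
    ENNReal.ofReal r ≤ Metric.ediam (Metric.closedBall x r) := by
  have h := Metric.diam_closedBall_eq x hr
  rw [Metric.diam] at h
  refine (ENNReal.ofReal_le_ofReal (by linarith : r ≤ 2 * r)).trans ?_
  rw [← h, ENNReal.ofReal_toReal]
  exact Metric.isBounded_closedBall.ediam_ne_top

theorem card_mul_rpow_le_packingSup [Nontrivial V] {s δ r : ℝ} (hs : 0 ≤ s) (hr : 0 < r)
    (hrδ : r ≤ δ) {A : Set V} {t : Finset V} (htA : ↑t ⊆ A)
    (hts : (t : Set V).Pairwise fun x y => 2 * r < dist x y) :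
    t.card * ENNReal.ofReal r ^ s ≤ packingSup s δ A := by
  set T : Set (V × ℝ) := (fun x => (x, r)) '' (t : Set V) with hT
  have hinj : Function.Injective fun x : V => (x, r) := fun x y h => congrArg Prod.fst h
  have hp : IsPacking δ A T := by
    refine ⟨(t.countable_toSet).image _, ?_, ?_⟩
    · rintro _ ⟨x, hx, rfl⟩
      exact ⟨htA hx, hr, hrδ⟩
    · rintro _ ⟨x, hx, rfl⟩ _ ⟨y, hy, rfl⟩ hxy
      have := hts hx hy fun h => hxy (by rw [h])
      exact Metric.closedBall_disjoint_closedBall (by linarith)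
  refine le_trans ?_ (le_iSup₂ (f := fun (t : Set (V × ℝ)) (_ : IsPacking δ A t) =>
    ∑' p : t, Metric.ediam (Metric.closedBall p.1.1 p.1.2) ^ s) T hp)
  rw [hT, tsum_image (fun p : V × ℝ => Metric.ediam (Metric.closedBall p.1 p.2) ^ s)
    hinj.injOn]
  calc (t.card : ℝ≥0∞) * ENNReal.ofReal r ^ s = ∑ x ∈ t, ENNReal.ofReal r ^ s := by simp
    _ ≤ ∑ x ∈ t, Metric.ediam (Metric.closedBall x r) ^ s := Finset.sum_le_sum fun x _ =>
        ENNReal.rpow_le_rpow (ofReal_le_ediam_closedBall x hr.le) hs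
    _ = ∑' x : (t : Set V), Metric.ediam (Metric.closedBall (x : V) r) ^ s :=
        (Finset.tsum_subtype' t fun x => Metric.ediam (Metric.closedBall x r) ^ s).symm

/-- Otherwise there are `⌊r ^ (-s)⌋₊ + 1` points more than `2 * r` apart; the balls of radius `r`
about them form a packing of `s`-sum at least 1. -/
theorem exists_cover_of_packingSup_lt_one [Nontrivial V] {s δ r : ℝ} (hs : 0 ≤ s) (hr : 0 < r)
    (hrδ : r ≤ δ) {A : Set V} (hA : packingSup s δ A < 1) :
    ∃ t : Finset V, A ⊆ (⋃ x ∈ t, Metric.closedBall x (2 * r)) ∧ (t.card : ℝ) ≤ r ^ (-s) := by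
  by_contra! hcon
  obtain ⟨t, htA, htn, hts⟩ := exists_separated_finset (A := A) (ε := 2 * r) (by positivity)
    (⌊r ^ (-s)⌋₊ + 1) fun t _ htn hcov =>
      absurd ((Nat.cast_le.2 (Nat.lt_succ_iff.1 htn)).trans (Nat.floor_le (by positivity)))
        (hcon t hcov).not_ge
  have h1 := (card_mul_rpow_le_packingSup hs hr hrδ htA hts).trans_lt hA
  refine h1.not_ge ?_
  rw [ENNReal.ofReal_rpow_of_pos hr, ← ENNReal.ofReal_natCast, ← ENNReal.ofReal_mul (by positivity),
    ← ENNReal.ofReal_one]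
  refine ENNReal.ofReal_le_ofReal ?_
  rw [htn, Nat.cast_add_one]
  calc (1 : ℝ) = r ^ (-s) * r ^ s := by rw [← Real.rpow_add hr]; simp
    _ ≤ _ := by gcongr; exact (Nat.lt_floor_add_one _).le

theorem upperCorrelationDimMeasure_le_of_packingMeasure_eq_zero [Nontrivial V]
    [MeasurableSpace V] [BorelSpace V] (μ : Measure V) [IsProbabilityMeasure μ] {E : Set V}
    (hμ : μ Eᶜ = 0) {s : ℝ≥0} (hE : packingMeasure (s : ℝ) E = 0) :
    upperCorrelationDimMeasure μ ≤ s := by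
  have hlt : packingMeasure (s : ℝ) E < 1 := by rw [hE]; exact zero_lt_one
  simp only [packingMeasure, iInf_lt_iff] at hlt
  obtain ⟨F, hEF, hF⟩ := hlt
  have hU : μ (⋃ i, F i) ≠ 0 := fun h0 => by
    have h1 : μ Set.univ ≤ μ E + μ Eᶜ := by
      rw [← Set.union_compl_self E]
      exact measure_union_le _ _
    rw [hμ, measure_mono_null hEF h0, measure_univ] at h1
    simp at h1
  obtain ⟨i, hi⟩ : ∃ i, μ (F i) ≠ 0 := by
    by_contra! h
    exact hU (measure_iUnion_null h)
  have hFi : packingPremeasure (s : ℝ) (F i) < 1 := (ENNReal.le_tsum i).trans_lt hF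
  simp only [packingPremeasure, iInf_lt_iff] at hFi
  obtain ⟨δ, hδ, hFδ⟩ := hFi
  set c := (μ (F i)).toReal with hc
  have hc0 : 0 < c := ENNReal.toReal_pos hi (measure_ne_top _ _)
  refine upperCorrelationDimMeasure_le_of_eventually μ
    -- Packing at radius `r / 4` gives a cover at radius `r / 2`, and pigeonhole doubles this to
    -- `r`. Its two halvings give `c ^ 2 / 4`; the power of 4 comes from `(r / 4) ^ s`.
    (C := c ^ 2 / 4 * ((4 : ℝ) ^ (s : ℝ))⁻¹) (by positivity) ?_
  filter_upwards [Ioo_mem_nhdsGT hδ] with r hr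
  have hr4 : 0 < r / 4 := by linarith [hr.1]
  obtain ⟨t, htcov, htcard⟩ := exists_cover_of_packingSup_lt_one s.2 hr4
    (by linarith [hr.1, hr.2]) hFδ
  have h := le_correlationIntegral_of_subset μ htcov hi
  rw [show 2 * (2 * (r / 4)) = r by ring] at h
  have h' := ENNReal.toReal_mono
    ((correlationIntegral_le_one μ r).trans_lt ENNReal.one_lt_top).ne h
  have hN : 0 < (t.card : ℝ) := by
    rw [Nat.cast_pos, Finset.card_pos, Finset.nonempty_iff_ne_empty]
    rintro rfl
    exact hi (measure_mono_null htcov (by simp))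
  simp only [ENNReal.toReal_mul, ENNReal.toReal_div, ENNReal.toReal_ofNat,
    ENNReal.toReal_natCast, ← hc] at h'
  refine le_trans ?_ h'
  have hinv : (r / 4) ^ (s : ℝ) ≤ (t.card : ℝ)⁻¹ := by
    rw [le_inv_comm₀ (by positivity) hN, ← Real.rpow_neg hr4.le]
    exact htcard
  calc c ^ 2 / 4 * ((4 : ℝ) ^ (s : ℝ))⁻¹ * r ^ (s : ℝ) = c ^ 2 / 4 * (r / 4) ^ (s : ℝ) := by
        rw [Real.div_rpow hr.1.le (by norm_num)]; ring
    _ ≤ c ^ 2 / 4 * (t.card : ℝ)⁻¹ := by gcongr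
    _ = c / (2 * t.card) * (c / 2) := by field_simp; norm_num

end Packing

/-- The degenerate case `d = 0`, where balls have diameter 0 and the packing estimate fails. -/
theorem upperCorrelationDimMeasure_of_subsingleton {X : Type*} [MetricSpace X]
    [MeasurableSpace X] [Subsingleton X] (μ : Measure X) [IsProbabilityMeasure μ] :
    upperCorrelationDimMeasure μ = 0 := by
  refine le_antisymm (limsup_le_of_le (by isBoundedDefault) ?_) zero_le
  filter_upwards [self_mem_nhdsWithin] with r hr
  have hball : ∀ x : X, Metric.closedBall x r = Set.univ := fun x => by
    ext y
    simp [Subsingleton.elim y x, (Set.mem_Ioi.1 hr).le]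
  simp [correlationIntegral, hball]

theorem upperCorrelationDim_le_packingDim {V : Type*} [NormedAddCommGroup V] [NormedSpace ℝ V]
    [MeasurableSpace V] [BorelSpace V] (E : Set V) : upperCorrelationDim E ≤ packingDim E := by
  refine iSup_le fun μ => iSup₂_le fun hμ hE => ?_
  rcases subsingleton_or_nontrivial V with hV | hV
  · rw [upperCorrelationDimMeasure_of_subsingleton]
    exact zero_le
  · exact le_iInf₂ fun s hs => upperCorrelationDimMeasure_le_of_packingMeasure_eq_zero μ hE hs

/-! ### Countable stability and localisation of the modified lower box dimension -/

section ModifiedLowerBoxDim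

variable {X Y : Type*} [MetricSpace Y]

theorem lowerBoxDim_empty : lowerBoxDim (∅ : Set Y) = 0 := by
  have h : ∀ r : ℝ, coverNumber r (∅ : Set Y) = 0 := fun r =>
    Nat.le_zero.1 (Nat.sInf_le ⟨fun i => i.elim0, fun i => i.elim0, Set.empty_subset _⟩)
  simp [lowerBoxDim, h]

theorem modifiedLowerBoxDim_mono {A B : Set Y} (h : A ⊆ B) :
    modifiedLowerBoxDim A ≤ modifiedLowerBoxDim B :=
  iInf_mono fun _ => iInf_mono fun _ => iInf_mono' fun hB => ⟨h.trans hB, le_rfl⟩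

theorem modifiedLowerBoxDim_le_lowerBoxDim {A B : Set Y} (h : A ⊆ B) (hB : IsCompact B) :
    modifiedLowerBoxDim A ≤ lowerBoxDim B :=
  (iInf_le _ fun _ => B).trans <| (iInf_le _ fun _ => hB).trans <|
    (iInf_le _ (h.trans (Set.subset_iUnion (fun _ : ℕ => B) 0))).trans (iSup_le fun _ => le_rfl)

theorem modifiedLowerBoxDim_iUnion_le {ι : Type*} [Countable ι] {A : ι → Set Y} {s : ℝ≥0∞}
    (h : ∀ i, modifiedLowerBoxDim (A i) ≤ s) : modifiedLowerBoxDim (⋃ i, A i) ≤ s := by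
  rcases isEmpty_or_nonempty ι with hι | hι
  · rw [Set.iUnion_of_empty]
    refine (modifiedLowerBoxDim_le_lowerBoxDim subset_rfl isCompact_empty).trans ?_
    rw [lowerBoxDim_empty]
    exact zero_le
  refine le_of_forall_gt_imp_ge_of_dense fun c hc => ?_
  have hF : ∀ i, ∃ F : ℕ → Set Y, (∀ j, IsCompact (F j)) ∧ A i ⊆ ⋃ j, F j ∧
      ∀ j, lowerBoxDim (F j) ≤ c := fun i => by
    have := (h i).trans_lt hc
    simp only [modifiedLowerBoxDim, iInf_lt_iff] at this
    obtain ⟨F, h1, h2, h3⟩ := this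
    exact ⟨F, h1, h2, fun j => (le_iSup (fun j => lowerBoxDim (F j)) j).trans h3.le⟩
  choose F hFc hFA hFd using hF
  obtain ⟨e, he⟩ := exists_surjective_nat (ι × ℕ)
  refine (iInf_le _ fun n => F (e n).1 (e n).2).trans <| (iInf_le _ fun n => hFc _ _).trans <|
    (iInf_le _ (Set.iUnion_subset fun i y hy => ?_)).trans (iSup_le fun n => hFd _ _)
  obtain ⟨j, hj⟩ := Set.mem_iUnion.1 (hFA i hy)
  obtain ⟨n, hn⟩ := he (i, j)
  exact Set.mem_iUnion.2 ⟨n, by rwa [hn]⟩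

theorem modifiedLowerBoxDim_union_le {A B : Set Y} {s : ℝ≥0∞} (hA : modifiedLowerBoxDim A ≤ s)
    (hB : modifiedLowerBoxDim B ≤ s) : modifiedLowerBoxDim (A ∪ B) ≤ s := by
  rw [Set.union_eq_iUnion]
  exact modifiedLowerBoxDim_iUnion_le fun b => by cases b <;> assumption

/-- The domain contains a set all of whose relatively open pieces have an image of large
dimension. -/
theorem exists_modifiedLowerBoxDim_kernel [TopologicalSpace X] [SecondCountableTopology X]
    (f : X → Y) {s : ℝ≥0∞} (h : s < modifiedLowerBoxDim (Set.range f)) :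
    ∃ K : Set X, K.Nonempty ∧
      ∀ x ∈ K, ∀ U ∈ 𝓝 x, s < modifiedLowerBoxDim (f '' (U ∩ K)) := by
  set K : Set X := {x | ∀ U ∈ 𝓝 x, s < modifiedLowerBoxDim (f '' U)} with hK
  have hKc : modifiedLowerBoxDim (f '' Kᶜ) ≤ s := by
    -- By the Lindelöf property countably many neighbourhoods with small image cover `Kᶜ`, and
    -- countable stability applies.
    have hex : ∀ x : X, ∃ U ∈ 𝓝 x, x ∈ Kᶜ → modifiedLowerBoxDim (f '' U) ≤ s := fun x => by
      by_cases hx : x ∈ K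
      · exact ⟨Set.univ, univ_mem, fun h => absurd hx h⟩
      · simp only [hK, Set.mem_ofPred_eq, not_forall, not_lt] at hx
        obtain ⟨U, hU, hUs⟩ := hx
        exact ⟨U, hU, fun _ => hUs⟩
    choose U hU hUs using hex
    obtain ⟨t, htK, htc, ht⟩ := TopologicalSpace.countable_cover_nhdsWithin (s := Kᶜ) (f := U)
      fun x _ => mem_nhdsWithin_of_mem_nhds (hU x)
    have := htc.to_subtype
    have hsub : f '' Kᶜ ⊆ ⋃ x : t, f '' U x := by
      rintro _ ⟨y, hy, rfl⟩
      obtain ⟨x, hx, hyx⟩ := Set.mem_iUnion₂.1 (ht hy)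
      exact Set.mem_iUnion.2 ⟨⟨x, hx⟩, y, hyx, rfl⟩
    exact (modifiedLowerBoxDim_mono hsub).trans
      (modifiedLowerBoxDim_iUnion_le fun x => hUs x (htK x.2))
  -- Discarding `Kᶜ`, whose image has dimension at most `s`, cannot bring the dimension down to `s`.
  have hcut : ∀ U : Set X, s < modifiedLowerBoxDim (f '' U) →
      s < modifiedLowerBoxDim (f '' (U ∩ K)) := fun U hU => by
    by_contra! hle
    refine hU.not_ge ((modifiedLowerBoxDim_mono ?_).trans
      (modifiedLowerBoxDim_union_le hle hKc))
    rw [← Set.image_union]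
    refine Set.image_mono fun y hy => ?_
    by_cases hyK : y ∈ K
    · exact Or.inl ⟨hy, hyK⟩
    · exact Or.inr hyK
  refine ⟨K, ?_, fun x hx U hU => hcut U (hx U hU)⟩
  by_contra! hne
  rw [hne, Set.compl_empty, Set.image_univ] at hKc
  exact h.not_ge hKc

theorem eventually_rpow_le_coverNumber {A : Set Y} {s : ℝ≥0} (h : (s : ℝ≥0∞) < lowerBoxDim A)
    {c : ℝ} (hc : 0 < c) :
    ∀ᶠ r in 𝓝[>] (0 : ℝ), r ^ (-(s : ℝ)) ≤ coverNumber (c * r) A := by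
  -- The gap between `s` and `t` absorbs the factor `c ^ (-t)` caused by rescaling.
  obtain ⟨t, hst, htA⟩ := ENNReal.lt_iff_exists_nnreal_btwn.1 h
  have hst : (s : ℝ) < t := by exact_mod_cast hst
  have hscale : Tendsto (fun r : ℝ => c * r) (𝓝[>] 0) (𝓝[>] 0) := by
    refine tendsto_nhdsWithin_iff.2 ⟨?_, ?_⟩
    · have : Tendsto (fun r : ℝ => c * r) (𝓝 0) (𝓝 (c * 0)) :=
        (continuous_const.mul continuous_id).tendsto 0
      rw [mul_zero] at this
      exact this.mono_left nhdsWithin_le_nhds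
    · filter_upwards [self_mem_nhdsWithin] with r hr
      exact mul_pos hc hr
  have hev := hscale.eventually (eventually_lt_of_lt_liminf htA)
  have hlim : Tendsto (fun r : ℝ => r ^ ((t : ℝ) - s)) (𝓝[>] 0) (𝓝 0) := by
    have hpos : 0 < (t : ℝ) - s := sub_pos.2 hst
    have : Tendsto (fun r : ℝ => r ^ ((t : ℝ) - s)) (𝓝 0) (𝓝 ((0 : ℝ) ^ ((t : ℝ) - s))) :=
      (Real.continuousAt_rpow_const 0 _ (Or.inr hpos.le)).tendsto
    rw [Real.zero_rpow hpos.ne'] at this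
    exact this.mono_left nhdsWithin_le_nhds
  filter_upwards [hev, hlim.eventually_le_const (show 0 < c ^ (-(t : ℝ)) by positivity),
    self_mem_nhdsWithin, hscale.eventually (Ioo_mem_nhdsGT (zero_lt_one' ℝ))] with r h1 h2 hr0 hr1
  have hr0 : 0 < r := hr0
  have hlog : 0 < -Real.log (c * r) := neg_pos.2 (Real.log_neg hr1.1 hr1.2)
  rw [← ENNReal.ofReal_coe_nnreal] at h1
  have h3 := (ENNReal.ofReal_lt_ofReal_iff_of_nonneg t.2).1 h1
  have h3 : (t : ℝ) * -Real.log (c * r) < Real.log (coverNumber (c * r) A) :=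
    (lt_div_iff₀ hlog).1 h3
  have hN : 0 < (coverNumber (c * r) A : ℝ) := by
    rw [Nat.cast_pos, Nat.pos_iff_ne_zero]
    intro h0
    rw [h0, Nat.cast_zero, Real.log_zero] at h3
    exact h3.not_ge (mul_nonneg t.2 hlog.le)
  calc r ^ (-(s : ℝ)) = r ^ ((t : ℝ) - s) * r ^ (-(t : ℝ)) := by
        rw [← Real.rpow_add hr0]; congr 1; ring
    _ ≤ c ^ (-(t : ℝ)) * r ^ (-(t : ℝ)) := by gcongr
    _ = (c * r) ^ (-(t : ℝ)) := (Real.mul_rpow hc.le hr0.le).symm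
    _ ≤ coverNumber (c * r) A := by
        rw [← Real.log_le_log_iff (Real.rpow_pos_of_pos hr1.1 _) hN, Real.log_rpow hr1.1]
        linarith

end ModifiedLowerBoxDim

/-! ### Cantor construction of a measure with small correlation integrals -/

section Construction

variable {X Y : Type*} [MetricSpace X] [MetricSpace Y]

/-- Validity at all small `r`, not just along a sequence, lets finitely many nodes share one scale.
A cover by balls of radius `4 * r` has sets of diameter at most `8 * r`, hence the factor 8 in the
proof. -/
theorem eventually_exists_separated_finset [ProperSpace Y] {A : Set Y}
    (hA : Bornology.IsBounded A) {s : ℝ≥0} (hs : (s : ℝ≥0∞) < modifiedLowerBoxDim A) :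
    ∀ᶠ r in 𝓝[>] (0 : ℝ), ∃ t : Finset Y, ↑t ⊆ A ∧ t.card = ⌈r ^ (-(s : ℝ))⌉₊ ∧
      (t : Set Y).Pairwise fun x y => 4 * r < dist x y := by
  have hc : IsCompact (closure A) := Metric.isCompact_of_isClosed_isBounded isClosed_closure
    hA.closure
  have hlt := hs.trans_le (modifiedLowerBoxDim_le_lowerBoxDim subset_closure hc)
  filter_upwards [eventually_rpow_le_coverNumber hlt (show (0 : ℝ) < 8 by norm_num),
    self_mem_nhdsWithin] with r hr hr0
  have hr0 : 0 < r := hr0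
  refine exists_separated_finset (by positivity) _ fun t _ htn hcov => ?_
  have h1 := coverNumber_closure_le (show 2 * (4 * r) ≤ 8 * r by linarith) hcov
  exact (hr.trans (Nat.cast_le.2 h1)).not_gt (Nat.lt_ceil.1 htn)

theorem exists_cantor_step [ProperSpace Y] {f : X → Y} (hf : Continuous f) {K : Set X} {s : ℝ≥0}
    (hK : ∀ x ∈ K, ∀ U ∈ 𝓝 x, (s : ℝ≥0∞) < modifiedLowerBoxDim (f '' (U ∩ K)))
    {S : Finset X} (hS : ↑S ⊆ K) {ρ r : ℝ} (hρ : 0 < ρ) (hr : 0 < r) :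
    ∃ r' ρ' : ℝ, ∃ L : ℕ, ∃ q : X → Fin (L + 1) → X, 0 < r' ∧ r' ≤ r / 2 ∧ 0 < ρ' ∧
      ρ' ≤ ρ / 2 ∧ r' ^ (-(s : ℝ)) ≤ L + 1 ∧ ∀ x ∈ S,
        (∀ j, q x j ∈ K ∧ dist (q x j) x ≤ ρ / 2 ∧
          ∀ y, dist y (q x j) ≤ ρ' → dist (f y) (f (q x j)) ≤ r') ∧
        ∀ i j, i ≠ j → 4 * r' < dist (f (q x i)) (f (q x j)) := by
  -- The second factor keeps the image bounded, so that its closure is compact.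
  set U : X → Set X := fun x => Metric.closedBall x (ρ / 2) ∩ f ⁻¹' Metric.ball (f x) 1
  have hUn : ∀ x, U x ∈ 𝓝 x := fun x => inter_mem (Metric.closedBall_mem_nhds x (half_pos hρ))
    (hf.continuousAt (Metric.ball_mem_nhds _ one_pos))
  have hsep : ∀ᶠ r' in 𝓝[>] (0 : ℝ), ∀ x ∈ S, ∃ t : Finset Y, ↑t ⊆ f '' (U x ∩ K) ∧
      t.card = ⌈r' ^ (-(s : ℝ))⌉₊ ∧ (t : Set Y).Pairwise fun x y => 4 * r' < dist x y := by
    refine (Filter.eventually_all_finset S).2 fun x hx => ?_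
    refine eventually_exists_separated_finset ?_ (hK x (hS hx) _ (hUn x))
    exact (Metric.isBounded_ball (x := f x) (r := 1)).subset
      (Set.image_subset_iff.2 fun y hy => hy.1.2)
  obtain ⟨r', hsep, hr'⟩ := (hsep.and (Ioo_mem_nhdsGT (half_pos hr))).exists
  have hr'0 : 0 < r' := hr'.1
  have hceil : 0 < ⌈r' ^ (-(s : ℝ))⌉₊ := Nat.ceil_pos.2 (by positivity)
  obtain ⟨L, hL⟩ := Nat.exists_eq_succ_of_ne_zero hceil.ne'
  have hq : ∀ x, ∃ g : Fin (L + 1) → X, x ∈ S → (∀ j, g j ∈ U x ∩ K) ∧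
      ∀ i j, i ≠ j → 4 * r' < dist (f (g i)) (f (g j)) := fun x => by
    by_cases hx : x ∈ S
    · obtain ⟨t, htA, htc, hts⟩ := hsep x hx
      let e : Fin (L + 1) ≃ t := (t.equivFinOfCardEq (htc.trans hL)).symm
      choose g hg hgf using fun j => htA (e j).2
      refine ⟨g, fun _ => ⟨hg, fun i j hij => ?_⟩⟩
      rw [hgf, hgf]
      exact hts (e i).2 (e j).2 fun h => hij (e.injective (Subtype.ext h))
    · exact ⟨fun _ => x, fun h => absurd h hx⟩
  choose q hq using hq
  have hmod : ∀ᶠ ρ' in 𝓝[>] (0 : ℝ), ∀ x ∈ S, ∀ j, ∀ y, dist y (q x j) ≤ ρ' →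
      dist (f y) (f (q x j)) ≤ r' := by
    refine (Filter.eventually_all_finset S).2 fun x _ => Filter.eventually_all.2 fun j => ?_
    obtain ⟨ε, hε, h⟩ := Metric.continuous_iff.1 hf (q x j) r' hr'0
    filter_upwards [Ioo_mem_nhdsGT hε] with ρ' hρ' y hy
    exact (h y (hy.trans_lt hρ'.2)).le
  obtain ⟨ρ', hmod, hρ'⟩ := (hmod.and (Ioo_mem_nhdsGT (half_pos hρ))).exists
  refine ⟨r', ρ', L, q, hr'0, hr'.2.le, hρ'.1, hρ'.2.le, ?_, fun x hx =>
    ⟨fun j => ⟨((hq x hx).1 j).2, ((hq x hx).1 j).1.1, hmod x hx j⟩, (hq x hx).2⟩⟩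
  calc r' ^ (-(s : ℝ)) ≤ ⌈r' ^ (-(s : ℝ))⌉₊ := Nat.le_ceil _
    _ = L + 1 := by rw [hL]; push_cast; rfl

/-- The data of a Cantor construction in the domain of `f`: the finite sets `S n` of nodes, the
children `q n x j` of the node `x ∈ S n`, and the scales of separation in both spaces. -/
theorem exists_cantor_scheme [ProperSpace Y] {f : X → Y} (hf : Continuous f) {K : Set X}
    {s : ℝ≥0} (hK : ∀ x ∈ K, ∀ U ∈ 𝓝 x, (s : ℝ≥0∞) < modifiedLowerBoxDim (f '' (U ∩ K)))
    {x₀ : X} (hx₀ : x₀ ∈ K) :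
    ∃ (S : ℕ → Set X) (ρ r : ℕ → ℝ) (L : ℕ → ℕ) (q : ∀ n, X → Fin (L n + 1) → X),
      x₀ ∈ S 0 ∧ r 0 = 1 ∧ ∀ n, 0 < r (n + 1) ∧ r (n + 1) ≤ r n / 2 ∧
        0 < ρ (n + 1) ∧ ρ (n + 1) ≤ ρ n / 2 ∧ r (n + 1) ^ (-(s : ℝ)) ≤ L n + 1 ∧
        ∀ x ∈ S n,
          (∀ j, q n x j ∈ S (n + 1) ∧ dist (q n x j) x ≤ ρ n / 2 ∧
            ∀ y, dist y (q n x j) ≤ ρ (n + 1) → dist (f y) (f (q n x j)) ≤ r (n + 1)) ∧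
          ∀ i j, i ≠ j → 4 * r (n + 1) < dist (f (q n x i)) (f (q n x j)) := by
  classical
  -- A state consists of the nodes, the scale `ρ` in `X` and the scale `r` in `Y`; the invariant is
  -- what the next step needs.
  let good : Set (Finset X × ℝ × ℝ) := {a | ↑a.1 ⊆ K ∧ 0 < a.2.1 ∧ 0 < a.2.2}
  have hstep : ∀ a : good, ∃ b : good, ∃ (L : ℕ) (q : X → Fin (L + 1) → X),
      b.1.2.2 ≤ a.1.2.2 / 2 ∧ b.1.2.1 ≤ a.1.2.1 / 2 ∧ b.1.2.2 ^ (-(s : ℝ)) ≤ L + 1 ∧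
      ∀ x ∈ a.1.1, (∀ j, q x j ∈ b.1.1 ∧ dist (q x j) x ≤ a.1.2.1 / 2 ∧
          ∀ y, dist y (q x j) ≤ b.1.2.1 → dist (f y) (f (q x j)) ≤ b.1.2.2) ∧
        ∀ i j, i ≠ j → 4 * b.1.2.2 < dist (f (q x i)) (f (q x j)) := by
    rintro ⟨⟨S, ρ, r⟩, hS, hρ, hr⟩
    obtain ⟨r', ρ', L, q, hr0, hr', hρ0, hρ', hL, hq⟩ := exists_cantor_step hf hK hS hρ hr
    refine ⟨⟨⟨S.biUnion fun x => Finset.univ.image (q x), ρ', r'⟩, ?_, hρ0, hr0⟩, L, q, hr', hρ',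
      hL, fun x hx => ⟨fun j => ⟨?_, ((hq x hx).1 j).2⟩, (hq x hx).2⟩⟩
    · intro y hy
      simp only [Finset.coe_biUnion, Set.mem_iUnion, Finset.mem_coe, Finset.mem_image] at hy
      obtain ⟨x, hx, j, -, rfl⟩ := hy
      exact ((hq x hx).1 j).1
    · exact Finset.mem_biUnion.2 ⟨x, hx, Finset.mem_image_of_mem _ (Finset.mem_univ j)⟩
  choose next hnext using hstep
  let a₀ : good := ⟨⟨{x₀}, 1, 1⟩, by simpa using hx₀, one_pos, one_pos⟩
  let st : ℕ → good := fun n => next^[n] a₀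
  have hst : ∀ n, st (n + 1) = next (st n) := fun n => Function.iterate_succ_apply' _ _ _
  choose L q h1 h2 h3 h4 using fun n => hnext (st n)
  simp only [← hst] at h1 h2 h3 h4
  refine ⟨fun n => (st n).1.1, fun n => (st n).1.2.1, fun n => (st n).1.2.2, L, q,
    Finset.mem_singleton_self x₀, rfl, fun n =>
      ⟨(st (n + 1)).2.2.2, h1 n, (st (n + 1)).2.2.1, h2 n, h3 n, h4 n⟩⟩

theorem exists_measure_correlationIntegral_le [CompleteSpace X] [ProperSpace Y]
    [MeasurableSpace Y] [BorelSpace Y] {f : X → Y} (hf : Continuous f)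
    (hrange : MeasurableSet (Set.range f)) {K : Set X} (hKne : K.Nonempty) {s : ℝ≥0}
    (hK : ∀ x ∈ K, ∀ U ∈ 𝓝 x, (s : ℝ≥0∞) < modifiedLowerBoxDim (f '' (U ∩ K))) :
    ∃ (μ : Measure Y) (r : ℕ → ℝ), IsProbabilityMeasure μ ∧ μ (Set.range f)ᶜ = 0 ∧
      (∀ n, 0 < r n) ∧ Tendsto r atTop (𝓝 0) ∧
      ∀ n, correlationIntegral μ (r n) ≤ ENNReal.ofReal (r n ^ (s : ℝ)) := by
  obtain ⟨x₀, hx₀⟩ := hKne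
  obtain ⟨S, ρ, r, L, q, hS0, hr1, h⟩ := exists_cantor_scheme hf hK hx₀
  have hr0 : ∀ n, 0 < r n := fun n => by
    cases n with
    | zero => rw [hr1]; exact one_pos
    | succ n => exact (h n).1
  have hranti : Antitone r := antitone_nat_of_succ_le fun n => by
    linarith [(h n).2.1, hr0 n]
  let p : ℕ → (∀ n, Fin (L n + 1)) → X := fun n ω => Nat.rec x₀ (fun n x => q n x (ω n)) n
  have hp : ∀ n ω, p (n + 1) ω = q n (p n ω) (ω n) := fun n ω => rfl
  have hpS : ∀ n ω, p n ω ∈ S n := fun n ω => by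
    induction n with
    | zero => exact hS0
    | succ n ih => exact (((h n).2.2.2.2.2 _ ih).1 (ω n)).1
  have hρgeo : ∀ n k, ρ (n + k) ≤ ρ n / 2 ^ k := fun n k => by
    induction k with
    | zero => simp
    | succ k ih =>
      have := (h (n + k)).2.2.2.1
      calc ρ (n + k + 1) ≤ ρ (n + k) / 2 := this
        _ ≤ ρ n / 2 ^ k / 2 := by gcongr
        _ = ρ n / 2 ^ (k + 1) := by rw [pow_succ]; field_simp
  -- Summed over `k`, these bounds give exactly `ρ n`, the radius in which the scheme controls `f`
  -- near the node when `n` is positive.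
  have hdist : ∀ n ω k, dist (p (n + k) ω) (p (n + (k + 1)) ω) ≤ ρ n / 2 / 2 ^ k := fun n ω k => by
    have h1 := (((h (n + k)).2.2.2.2.2 _ (hpS (n + k) ω)).1 (ω (n + k))).2.1
    rw [dist_comm]
    calc dist (p (n + (k + 1)) ω) (p (n + k) ω) ≤ ρ (n + k) / 2 := h1
      _ ≤ ρ n / 2 ^ k / 2 := by gcongr; exact hρgeo n k
      _ = ρ n / 2 / 2 ^ k := by ring
  have hlim : ∀ ω, ∃ x, Tendsto (fun n => p n ω) atTop (𝓝 x) := fun ω =>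
    cauchySeq_tendsto_of_complete (cauchySeq_of_le_geometric_two (C := ρ 0) fun n => by
      simpa using hdist 0 ω n)
  choose G hG using hlim
  have hGp : ∀ n ω, dist (G ω) (p n ω) ≤ ρ n := fun n ω => by
    rw [dist_comm]
    exact dist_le_of_le_geometric_two_of_tendsto₀ (f := fun k => p (n + k) ω) (hdist n ω)
      ((tendsto_add_atTop_iff_nat n).2 (hG ω) |>.congr fun k => by rw [add_comm])
  -- At the first index `m` where the branches differ they have a common parent. The images of the
  -- two children are more than `4 * r (m + 1)` apart and those of the limits within `r (m + 1)` of
  -- them, so the latter are more than `2 * r (m + 1)` apart.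
  have hsep : ∀ n ω ω', dist (f (G ω')) (f (G ω)) ≤ r (n + 1) → ∀ m ≤ n, ω' m = ω m := by
    intro n ω ω' hd m
    induction m using Nat.strong_induction_on with
    | _ m ih =>
      intro hmn
      have hpm : p m ω' = p m ω := by
        have : ∀ k ≤ m, p k ω' = p k ω := fun k => by
          induction k with
          | zero => exact fun _ => rfl
          | succ k ihk =>
            intro hk
            rw [hp, hp, ihk (by omega), ih k (by omega) (by omega)]
        exact this m le_rfl
      by_contra hne
      obtain ⟨hch, hch2⟩ := (h m).2.2.2.2.2 _ (hpS m ω)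
      have h1 := hch2 _ _ hne
      have h2 := (hch (ω m)).2.2 (G ω) (hGp (m + 1) ω)
      have h3 := (hch (ω' m)).2.2 (G ω') (by rw [← hpm]; exact hGp (m + 1) ω')
      have h5 : r (n + 1) ≤ r (m + 1) := hranti (by omega)
      have h6 := hr0 (m + 1)
      have h7 := dist_triangle4 (f (q m (p m ω) (ω' m))) (f (G ω')) (f (G ω))
        (f (q m (p m ω) (ω m)))
      rw [dist_comm _ (f (G ω'))] at h7
      linarith
  -- Each `p n` depends on finitely many coordinates, so `f ∘ G` is a pointwise limit of continuous
  -- maps, hence measurable.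
  have hploc : ∀ n, IsLocallyConstant (p n) := fun n => by
    induction n with
    | zero => exact IsLocallyConstant.const x₀
    | succ n ih =>
      have he : IsLocallyConstant fun ω : ∀ n, Fin (L n + 1) => ω n :=
        (IsLocallyConstant.iff_continuous _).2 (continuous_apply n)
      exact (ih.prodMk he).comp fun a => q n a.1 a.2
  have hFm : Measurable fun ω => f (G ω) :=
    measurable_of_tendsto_metrizable
      (fun n => (hf.comp (hploc n).continuous).measurable)
      (tendsto_pi_nhds.2 fun ω => (hf.tendsto _).comp (hG ω))
  let P : Measure (∀ n, Fin (L n + 1)) :=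
    Measure.infinitePi fun n => (PMF.uniformOfFintype (Fin (L n + 1))).toMeasure
  refine ⟨P.map fun ω => f (G ω), fun n => r (n + 1),
    Measure.isProbabilityMeasure_map hFm.aemeasurable, ?_, fun n => hr0 _, ?_, fun n => ?_⟩
  · rw [Measure.map_apply hFm hrange.compl]
    convert measure_empty (μ := P)
    ext ω
    simp
  · have hrgeo : ∀ n, r n ≤ (1 / 2) ^ n := fun n => by
      induction n with
      | zero => simp [hr1]
      | succ n ih =>
        rw [pow_succ]
        linarith [(h n).2.1]
    exact (tendsto_add_atTop_iff_nat 1).2 (squeeze_zero (fun n => (hr0 n).le) hrgeo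
      (tendsto_pow_atTop_nhds_zero_of_lt_one (by norm_num) (by norm_num)))
  · have hball : ∀ ω, P.map (fun ω => f (G ω)) (Metric.closedBall (f (G ω)) (r (n + 1))) ≤
        ENNReal.ofReal (r (n + 1) ^ (s : ℝ)) := fun ω => by
      rw [Measure.map_apply hFm Metric.isClosed_closedBall.measurableSet]
      calc P ((fun ω => f (G ω)) ⁻¹' Metric.closedBall (f (G ω)) (r (n + 1)))
          -- The last coordinate alone suffices: the number of children was already chosen to be at
          -- least `r (n + 1) ^ (-s)`.
          ≤ P ((fun ω' => ω' n) ⁻¹' {ω n}) :=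
            measure_mono fun ω' hω' => hsep n ω ω' hω' n le_rfl
        _ = (PMF.uniformOfFintype (Fin (L n + 1))).toMeasure {ω n} := by
            rw [← Measure.map_apply (measurable_pi_apply n) (measurableSet_singleton _),
              Measure.infinitePi_map_eval]
        _ = ENNReal.ofReal ((L n + 1 : ℝ)⁻¹) := by
            rw [PMF.toMeasure_uniformOfFintype_apply _ (measurableSet_singleton _),
              ENNReal.ofReal_inv_of_pos (by positivity)]
            simp [ENNReal.ofReal_add]
        _ ≤ ENNReal.ofReal (r (n + 1) ^ (s : ℝ)) := by
            refine ENNReal.ofReal_le_ofReal ?_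
            rw [inv_le_comm₀ (by positivity) (Real.rpow_pos_of_pos (hr0 _) _),
              ← Real.rpow_neg (hr0 _).le]
            exact (h n).2.2.2.2.1
    calc correlationIntegral (P.map fun ω => f (G ω)) (r (n + 1))
        ≤ ∫⁻ ω, P.map (fun ω => f (G ω)) (Metric.closedBall (f (G ω)) (r (n + 1))) ∂P :=
          -- The inequality suffices and spares the measurability of `x ↦ μ (B(x, r))`.
          lintegral_map_le _ _
      _ ≤ ∫⁻ _, ENNReal.ofReal (r (n + 1) ^ (s : ℝ)) ∂P := lintegral_mono hball
      _ = _ := by simp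

end Construction

/-! ### Conclusion of the lower bound -/

theorem le_upperCorrelationDimMeasure {Y : Type*} [MetricSpace Y] [SecondCountableTopology Y]
    [MeasurableSpace Y] [BorelSpace Y] (μ : Measure Y) [IsProbabilityMeasure μ] {s : ℝ≥0}
    {r : ℕ → ℝ} (hr0 : ∀ n, 0 < r n) (hr : Tendsto r atTop (𝓝 0))
    (h : ∀ n, correlationIntegral μ (r n) ≤ ENNReal.ofReal (r n ^ (s : ℝ))) :
    (s : ℝ≥0∞) ≤ upperCorrelationDimMeasure μ := by
  have hr' : Tendsto r atTop (𝓝[>] 0) := tendsto_nhdsWithin_iff.2 ⟨hr, Eventually.of_forall hr0⟩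
  refine le_limsup_of_frequently_le ?_ (by isBoundedDefault)
  refine hr'.frequently (Eventually.frequently ?_)
  filter_upwards [hr'.eventually (Ioo_mem_nhdsGT (zero_lt_one' ℝ))] with n hn
  have hlog : Real.log (r n) < 0 := Real.log_neg hn.1 hn.2
  have hI : 0 < (correlationIntegral μ (r n)).toReal :=
    ENNReal.toReal_pos (correlationIntegral_pos μ (hr0 n)).ne'
      ((correlationIntegral_le_one μ _).trans_lt ENNReal.one_lt_top).ne
  have h1 := Real.log_le_log hI
    (ENNReal.toReal_le_of_le_ofReal (Real.rpow_nonneg (hr0 n).le _) (h n))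
  rw [Real.log_rpow (hr0 n)] at h1
  rw [← ENNReal.ofReal_coe_nnreal]
  refine ENNReal.ofReal_le_ofReal ?_
  rwa [le_div_iff_of_neg hlog]

theorem modifiedLowerBoxDim_le_upperCorrelationDim {Y : Type*} [MetricSpace Y] [ProperSpace Y]
    [MeasurableSpace Y] [BorelSpace Y] {E : Set Y} (hE : MeasurableSet E) :
    modifiedLowerBoxDim E ≤ upperCorrelationDim E := by
  obtain ⟨X, _, _, f, hf, rfl⟩ := analyticSet_iff_exists_polishSpace_range.1 hE.analyticSet
  -- A complete compatible metric on the Polish space, in which the branches of the tree converge.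
  let _ := TopologicalSpace.upgradeIsCompletelyMetrizable X
  refine ENNReal.le_of_forall_nnreal_lt fun s hs => ?_
  obtain ⟨K, hKne, hK⟩ := exists_modifiedLowerBoxDim_kernel f hs
  obtain ⟨μ, r, hμ, hμE, hr0, hr, hle⟩ := exists_measure_correlationIntegral_le hf hE hKne hK
  exact (le_upperCorrelationDimMeasure μ hr0 hr hle).trans
    (le_iSup_of_le μ (le_iSup₂_of_le hμ hμE le_rfl))

end FractalDim

theorem mainTheorem2 (d : ℕ) (E : Set (EuclideanSpace ℝ (Fin d))) (hE : MeasurableSet E) :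
    FractalDim.modifiedLowerBoxDim E ≤ FractalDim.upperCorrelationDim E ∧
      FractalDim.upperCorrelationDim E ≤ FractalDim.packingDim E :=
  ⟨FractalDim.modifiedLowerBoxDim_le_upperCorrelationDim hE,
    FractalDim.upperCorrelationDim_le_packingDim E⟩
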